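/- Let $\pi : S' \to S$ be a faithfully flat (i.e. flat and surjective) and quasi-compact morphism of schemes. Write $p_1, p_2 : S' \times_S S' \to S'$ for the two projections and $p_{12}, p_{23}, p_{13} : S' \times_S S' \times_S S' \to S' \times_S S'$ for the projections onto pairs of factors. Let $X'$ be an $S'$-scheme equipped with a descent datum relative to $\pi$, that is, an isomorphism $\varphi : p_1^* X' \to p_2^* X'$ of schemes over $S' \times_S S'$ satisfying the cocycle condition $p_{13}^*\varphi = p_{23}^*\varphi \circ p_{12}^*\varphi$ over $S' \times_S S' \times_S S'$ (up to the canonical identifications of iterated pullbacks). Say that an $S$-scheme $X$ induces $(X', \varphi)$ if there is an $S'$-isomorphism $\pi^* X = X \times_S S' \cong X'$ compatible with $\varphi$ and with the canonical descent datum $p_1^*\pi^*X \cong p_2^*\pi^*X$ on $\pi^*X$; the descent datum is effective if such an $X$ exists. Suppose that the morphism $X' \to S'$ is affine (resp. an open immersion, resp. quasi-affine, meaning that the inverse image of every affine open subset is a quasi-affine scheme). Then the descent datum $\varphi$ is effective. Moreover, for every $S$-scheme $X$ that induces $(X', \varphi)$, the morphism $X \to S$ is affine (resp. an open immersion, resp.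 quasi-affine). -/

import Mathlib

universe u

open CategoryTheory CategoryTheory.Limits AlgebraicGeometry

namespace FpqcDescent

/-- A morphism of schemes is quasi-affine if the inverse image of every affine open subset of the
target is a quasi-affine scheme (that is, a quasi-compact open subscheme of an affine scheme). -/
class IsQuasiAffineHom {X Y : Scheme.{u}} (f : X ⟶ Y) : Prop where
  isQuasiAffine_preimage : ∀ U : Y.Opens, IsAffineOpen U → (f ⁻¹ᵁ U).toScheme.IsQuasiAffine

/-- The canonical isomorphism `g^* p^* X ≅ q^* X` of schemes over `T`, for `g ≫ p = q`. -/
noncomputable def pullbackCompIso {T V W : Scheme.{u}} (X : Over W) (g : T ⟶ V) (p : V ⟶ W)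
    (q : T ⟶ W) (h : g ≫ p = q) :
    (Over.pullback g).obj ((Over.pullback p).obj X) ≅ (Over.pullback q).obj X :=
  Over.isoMk (pullbackLeftPullbackSndIso X.hom p g ≪≫ pullback.congrHom rfl h)
    (by
      change ((pullbackLeftPullbackSndIso X.hom p g).hom ≫
        (pullback.congrHom (rfl : X.hom = X.hom) h).hom) ≫ pullback.snd X.hom q =
          pullback.snd (pullback.snd X.hom p) g
      rw [pullback.congrHom_hom, Category.assoc, pullback.map, pullback.lift_snd,
        Category.comp_id, pullbackLeftPullbackSndIso_hom_snd])

section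

variable {T V W : Scheme.{u}} (X : Over W) (g : T ⟶ V) (p : V ⟶ W) (q : T ⟶ W) (h : g ≫ p = q)

lemma pullbackCompIso_hom_left_fst :
    (pullbackCompIso X g p q h).hom.left ≫ pullback.fst X.hom q =
      pullback.fst (pullback.snd X.hom p) g ≫ pullback.fst X.hom p := by
  change ((pullbackLeftPullbackSndIso X.hom p g).hom ≫
    (pullback.congrHom (rfl : X.hom = X.hom) h).hom) ≫ pullback.fst X.hom q = _
  rw [pullback.congrHom_hom, Category.assoc, pullback.map, pullback.lift_fst,
    Category.comp_id, pullbackLeftPullbackSndIso_hom_fst]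

lemma pullbackCompIso_hom_left_snd :
    (pullbackCompIso X g p q h).hom.left ≫ pullback.snd X.hom q =
      pullback.snd (pullback.snd X.hom p) g :=
  Over.w (pullbackCompIso X g p q h).hom

lemma pullbackCompIso_inv_left_fst_fst :
    (pullbackCompIso X g p q h).inv.left ≫ pullback.fst (pullback.snd X.hom p) g ≫
      pullback.fst X.hom p = pullback.fst X.hom q := by
  rw [← pullbackCompIso_hom_left_fst X g p q h, ← Over.comp_left_assoc]
  simp

lemma pullbackCompIso_inv_left_snd :
    (pullbackCompIso X g p q h).inv.left ≫ pullback.snd (pullback.snd X.hom p) g =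
      pullback.snd X.hom q := by
  rw [← pullbackCompIso_hom_left_snd X g p q h, ← Over.comp_left_assoc]
  simp

end

variable {S S' : Scheme.{u}}

/-- The first projection `p₁ : S' ×[S] S' ⟶ S'`. -/
noncomputable abbrev p₁ (π : S' ⟶ S) : pullback π π ⟶ S' := pullback.fst π π

/-- The second projection `p₂ : S' ×[S] S' ⟶ S'`. -/
noncomputable abbrev p₂ (π : S' ⟶ S) : pullback π π ⟶ S' := pullback.snd π π

/-- The triple fibre product `S' ×[S] S' ×[S] S'`, built as the fibre product of the projections
`p₂` and `p₁` from `S' ×[S] S'` to the middle factor `S'`. -/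
noncomputable abbrev triple (π : S' ⟶ S) : Scheme.{u} := pullback (p₂ π) (p₁ π)

/-- The projection of the triple fibre product to the factors 1 and 2. -/
noncomputable abbrev p₁₂ (π : S' ⟶ S) : triple π ⟶ pullback π π := pullback.fst (p₂ π) (p₁ π)

/-- The projection of the triple fibre product to the factors 2 and 3. -/
noncomputable abbrev p₂₃ (π : S' ⟶ S) : triple π ⟶ pullback π π := pullback.snd (p₂ π) (p₁ π)

/-- The projection of the triple fibre product to the first factor. -/
noncomputable abbrev q₁ (π : S' ⟶ S) : triple π ⟶ S' := p₁₂ π ≫ p₁ π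

/-- The projection of the triple fibre product to the second factor. -/
noncomputable abbrev q₂ (π : S' ⟶ S) : triple π ⟶ S' := p₁₂ π ≫ p₂ π

/-- The projection of the triple fibre product to the third factor. -/
noncomputable abbrev q₃ (π : S' ⟶ S) : triple π ⟶ S' := p₂₃ π ≫ p₂ π

lemma p₂₃_p₁ (π : S' ⟶ S) : p₂₃ π ≫ p₁ π = q₂ π := pullback.condition.symm

lemma q₁_comp_eq_q₃_comp (π : S' ⟶ S) : q₁ π ≫ π = q₃ π ≫ π := by
  have e : p₁ π ≫ π = p₂ π ≫ π := pullback.condition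
  calc q₁ π ≫ π = p₁₂ π ≫ p₁ π ≫ π := Category.assoc _ _ _
    _ = q₂ π ≫ π := by rw [e, Category.assoc]
    _ = p₂₃ π ≫ p₁ π ≫ π := by rw [← p₂₃_p₁, Category.assoc]
    _ = q₃ π ≫ π := by rw [e, Category.assoc]

lemma q₂_comp_eq_q₃_comp (π : S' ⟶ S) : q₂ π ≫ π = q₃ π ≫ π := by
  rw [← p₂₃_p₁, Category.assoc, Category.assoc, pullback.condition (f := π) (g := π)]

/-- The projection of the triple fibre product to the factors 1 and 3. -/
noncomputable abbrev p₁₃ (π : S' ⟶ S) : triple π ⟶ pullback π π :=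
  pullback.lift (q₁ π) (q₃ π) (q₁_comp_eq_q₃_comp π)

/-- For a morphism `g : T ⟶ S' ×[S] S'` with components `a, b : T ⟶ S'`, the isomorphism
`g^* φ : a^* X' ≅ b^* X'` over `T` deduced from an isomorphism `φ : p₁^* X' ≅ p₂^* X'` over
`S' ×[S] S'` by base change, where `g^* p₁^* X'` and `g^* p₂^* X'` are identified with `a^* X'` and
`b^* X'` through the canonical isomorphisms. -/
noncomputable def pullIso {π : S' ⟶ S} {X' : Over S'}
    (φ : (Over.pullback (p₁ π)).obj X' ≅ (Over.pullback (p₂ π)).obj X')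
    {T : Scheme.{u}} (g : T ⟶ pullback π π) (a b : T ⟶ S')
    (ha : g ≫ p₁ π = a) (hb : g ≫ p₂ π = b) :
    (Over.pullback a).obj X' ≅ (Over.pullback b).obj X' :=
  (pullbackCompIso X' g (p₁ π) a ha).symm ≪≫ (Over.pullback g).mapIso φ ≪≫
    pullbackCompIso X' g (p₂ π) b hb

/-- A descent datum on the `S'`-scheme `X'` relative to `π : S' ⟶ S`: an isomorphism
`φ : p₁^* X' ≅ p₂^* X'` of schemes over `S' ×[S] S'` that satisfies the cocycle condition
`p₁₃^* φ = p₂₃^* φ ∘ p₁₂^* φ` over `S' ×[S] S' ×[S] S'`. -/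
structure DescentDatum (π : S' ⟶ S) (X' : Over S') where
  /-- The gluing isomorphism. -/
  φ : (Over.pullback (p₁ π)).obj X' ≅ (Over.pullback (p₂ π)).obj X'
  cocycle :
    pullIso φ (p₁₂ π) (q₁ π) (q₂ π) rfl rfl ≪≫ pullIso φ (p₂₃ π) (q₂ π) (q₃ π) (p₂₃_p₁ π) rfl =
      pullIso φ (p₁₃ π) (q₁ π) (q₃ π) (pullback.lift_fst _ _ _) (pullback.lift_snd _ _ _)

/-- The canonical isomorphism `p₁^* π^* X ≅ p₂^* π^* X` for a scheme `X` over `S`. -/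
noncomputable def canonicalIso (π : S' ⟶ S) (X : Over S) :
    (Over.pullback (p₁ π)).obj ((Over.pullback π).obj X) ≅
      (Over.pullback (p₂ π)).obj ((Over.pullback π).obj X) :=
  pullbackCompIso X (p₁ π) π (p₁ π ≫ π) rfl ≪≫
    (pullbackCompIso X (p₂ π) π (p₁ π ≫ π) pullback.condition.symm).symm

lemma canonicalIso_hom_left_fst_fst (π : S' ⟶ S) (X : Over S) :
    (canonicalIso π X).hom.left ≫ pullback.fst (pullback.snd X.hom π) (p₂ π) ≫
        pullback.fst X.hom π =
      pullback.fst (pullback.snd X.hom π) (p₁ π) ≫ pullback.fst X.hom π := by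
  change ((pullbackCompIso X (p₁ π) π (p₁ π ≫ π) rfl).hom.left ≫
    (pullbackCompIso X (p₂ π) π (p₁ π ≫ π) pullback.condition.symm).inv.left) ≫ _ = _
  rw [Category.assoc, pullbackCompIso_inv_left_fst_fst, pullbackCompIso_hom_left_fst]

lemma pullIso_canonicalIso (π : S' ⟶ S) (X : Over S) {T : Scheme.{u}} (g : T ⟶ pullback π π)
    (a b : T ⟶ S') (ha : g ≫ p₁ π = a) (hb : g ≫ p₂ π = b) (q : T ⟶ S) (hqa : a ≫ π = q)
    (hqb : b ≫ π = q) :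
    pullIso (canonicalIso π X) g a b ha hb =
      pullbackCompIso X a π q hqa ≪≫ (pullbackCompIso X b π q hqb).symm := by
  have key : (Over.pullback g).map (canonicalIso π X).hom ≫
      (pullbackCompIso _ g (p₂ π) b hb).hom ≫ (pullbackCompIso X b π q hqb).hom =
      (pullbackCompIso _ g (p₁ π) a ha).hom ≫ (pullbackCompIso X a π q hqa).hom := by
    ext1
    apply pullback.hom_ext (f := X.hom) (g := q)
    · have h₁ := pullbackCompIso_hom_left_fst X a π q hqa
      have h₂ := pullbackCompIso_hom_left_fst X b π q hqb
      have h₃ := pullbackCompIso_hom_left_fst ((Over.pullback π).obj X) g (p₁ π) a ha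
      have h₄ := pullbackCompIso_hom_left_fst ((Over.pullback π).obj X) g (p₂ π) b hb
      have h₅ := canonicalIso_hom_left_fst_fst π X
      have h₆ : ((Over.pullback g).map (canonicalIso π X).hom).left ≫
          pullback.fst (pullback.snd (pullback.snd X.hom π) (p₂ π)) g =
          pullback.fst (pullback.snd (pullback.snd X.hom π) (p₁ π)) g ≫
            (canonicalIso π X).hom.left := pullback.lift_fst _ _ _
      simp only [Over.comp_left, Category.assoc]
      refine (congrArg (_ ≫ _ ≫ ·) h₂).trans ?_
      refine Eq.trans ?_ (congrArg (_ ≫ ·) h₁).symm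
      refine (congrArg (_ ≫ ·) ((reassoc_of% h₄) _)).trans ?_
      refine ((reassoc_of% h₆) _).trans ?_
      refine Eq.trans ?_ ((reassoc_of% h₃) _).symm
      exact congrArg (_ ≫ ·) h₅
    · exact (Over.w ((Over.pullback g).map (canonicalIso π X).hom ≫
        (pullbackCompIso _ g (p₂ π) b hb).hom ≫ (pullbackCompIso X b π q hqb).hom)).trans
        (Over.w ((pullbackCompIso _ g (p₁ π) a ha).hom ≫ (pullbackCompIso X a π q hqa).hom)).symm
  ext1
  rw [← cancel_mono (pullbackCompIso X b π q hqb).hom,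
    ← cancel_epi (pullbackCompIso _ g (p₁ π) a ha).hom]
  simpa [pullIso] using key

/-- The descent datum on `π^* X` canonically attached to a scheme `X` over `S`. -/
noncomputable def DescentDatum.ofBase (π : S' ⟶ S) (X : Over S) :
    DescentDatum π ((Over.pullback π).obj X) where
  φ := canonicalIso π X
  cocycle := by
    rw [pullIso_canonicalIso π X (p₁₂ π) _ _ rfl rfl (q₂ π ≫ π)
        ((q₁_comp_eq_q₃_comp π).trans (q₂_comp_eq_q₃_comp π).symm) rfl,
      pullIso_canonicalIso π X (p₂₃ π) _ _ (p₂₃_p₁ π) rfl (q₂ π ≫ π) rfl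
        (q₂_comp_eq_q₃_comp π).symm,
      pullIso_canonicalIso π X (p₁₃ π) _ _ _ _ (q₂ π ≫ π)
        ((q₁_comp_eq_q₃_comp π).trans (q₂_comp_eq_q₃_comp π).symm) (q₂_comp_eq_q₃_comp π).symm]
    ext1
    simp

/-- The `S`-scheme `X` induces the `S'`-scheme `X'` together with its descent datum `D`: there is
an isomorphism `π^* X ≅ X'` over `S'` that is compatible with the canonical descent datum of
`π^* X` and with `D`. -/
def DescentDatum.IsInducedBy {π : S' ⟶ S} {X' : Over S'} (D : DescentDatum π X') (X : Over S) :
    Prop :=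
  ∃ e : (Over.pullback π).obj X ≅ X',
    (DescentDatum.ofBase π X).φ.hom ≫ (Over.pullback (p₂ π)).map e.hom =
      (Over.pullback (p₁ π)).map e.hom ≫ D.φ.hom

/-- A descent datum is effective if it is induced, up to isomorphism, by some `S`-scheme. -/
def DescentDatum.IsEffective {π : S' ⟶ S} {X' : Over S'} (D : DescentDatum π X') : Prop :=
  ∃ X : Over S, D.IsInducedBy X

end FpqcDescent

namespace FpqcDescent

/-- An action of the equivalence relation `S' ×[S] S'` on an `S'`-scheme `f : X' ⟶ S'`, given on
`T`-valued points: `act x s h` transports the point `x`, lying over `x ≫ f`, to the fibre over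
`s`. -/
structure PointAction {S S' X' : Scheme.{u}} (π : S' ⟶ S) (f : X' ⟶ S') where
  /-- The transport of a point `x` to the fibre over `s`. -/
  act : ∀ {T : Scheme.{u}} (x : T ⟶ X') (s : T ⟶ S'), x ≫ f ≫ π = s ≫ π → (T ⟶ X')
  act_comp : ∀ {T : Scheme.{u}} (x : T ⟶ X') (s : T ⟶ S') (h : x ≫ f ≫ π = s ≫ π),
    act x s h ≫ f = s
  act_self : ∀ {T : Scheme.{u}} (x : T ⟶ X') (s : T ⟶ S') (h : x ≫ f ≫ π = s ≫ π),
    x ≫ f = s → act x s h = x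
  act_act : ∀ {T : Scheme.{u}} (x : T ⟶ X') (s t : T ⟶ S') (h : x ≫ f ≫ π = s ≫ π)
    (h' : act x s h ≫ f ≫ π = t ≫ π) (h'' : x ≫ f ≫ π = t ≫ π),
    act (act x s h) t h' = act x t h''
  comp_act : ∀ {T U : Scheme.{u}} (v : U ⟶ T) (x : T ⟶ X') (s : T ⟶ S')
    (h : x ≫ f ≫ π = s ≫ π) (h' : (v ≫ x) ≫ f ≫ π = (v ≫ s) ≫ π),
    v ≫ act x s h = act (v ≫ x) (v ≫ s) h'

namespace PointAction

variable {S S' X' : Scheme.{u}} {π : S' ⟶ S} {f : X' ⟶ S'} (A : PointAction π f)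

lemma act_congr {T : Scheme.{u}} {x y : T ⟶ X'} {s t : T ⟶ S'} (hx : x = y) (hs : s = t)
    (h : x ≫ f ≫ π = s ≫ π) : A.act x s h = A.act y t (by rw [← hx, ← hs, h]) := by
  subst hx hs
  rfl

/-- A morphism out of `X'` is invariant if it does not change when points are transported. -/
def IsInvariant {X : Scheme.{u}} (q : X' ⟶ X) : Prop :=
  ∀ {T : Scheme.{u}} (x : T ⟶ X') (s : T ⟶ S') (h : x ≫ f ≫ π = s ≫ π), A.act x s h ≫ q = x ≫ q

/-- An `S`-scheme `g : X ⟶ S` with an invariant morphism `q : X' ⟶ X` identifying `X'` with the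
base change of `X` along `π`. -/
structure IsQuotient {X : Scheme.{u}} (q : X' ⟶ X) (g : X ⟶ S) : Prop where
  isPullback : IsPullback q f g π
  isInvariant : A.IsInvariant q

/-- The existence of a quotient of an action. -/
def HasQuotient : Prop :=
  ∃ (X : Scheme.{u}) (q : X' ⟶ X) (g : X ⟶ S), A.IsQuotient q g

section baseChange

variable {V T' X'' : Scheme.{u}} {v : V ⟶ S} {t : T' ⟶ S'} {π' : T' ⟶ V} {x'' : X'' ⟶ X'}
  {f'' : X'' ⟶ T'}

/-- The action induced on the base change of `X'` along `t : T' ⟶ S'`, over any base `V` through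
which `T'` maps to `S`. -/
noncomputable def baseChange (ht : t ≫ π = π' ≫ v) (H : IsPullback x'' f'' f t) :
    PointAction π' f'' where
  act y s h := H.lift (A.act (y ≫ x'') (s ≫ t) (by
      rw [Category.assoc, H.w_assoc, ht, Category.assoc, ht, reassoc_of% h])) s (A.act_comp _ _ _)
  act_comp y s h := H.lift_snd _ _ _
  act_self y s h e := by
    subst e
    apply H.hom_ext
    · rw [H.lift_fst, A.act_self]
      rw [Category.assoc, Category.assoc, H.w]
    · rw [H.lift_snd]
  act_act y s r h h' h'' := by
    apply H.hom_ext
    · refine (H.lift_fst _ _ _).trans (Eq.trans ?_ (H.lift_fst _ _ _).symm)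
      exact (A.act_congr (H.lift_fst _ _ _) rfl _).trans (A.act_act _ _ _ _ _ _)
    · rw [H.lift_snd, H.lift_snd]
  comp_act w y s h h' := by
    apply H.hom_ext
    · rw [H.lift_fst, Category.assoc, H.lift_fst, A.comp_act]
      · exact A.act_congr (Category.assoc _ _ _).symm (Category.assoc _ _ _).symm _
      · rw [Category.assoc, Category.assoc, H.w_assoc, ht, Category.assoc, Category.assoc, ht,
          reassoc_of% h]
    · rw [H.lift_snd, Category.assoc, H.lift_snd]

lemma baseChange_act_fst (ht : t ≫ π = π' ≫ v) (H : IsPullback x'' f'' f t) {T : Scheme.{u}}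
    (y : T ⟶ X'') (s : T ⟶ T') (h : y ≫ f'' ≫ π' = s ≫ π')
    (h' : (y ≫ x'') ≫ f ≫ π = (s ≫ t) ≫ π) :
    (A.baseChange ht H).act y s h ≫ x'' = A.act (y ≫ x'') (s ≫ t) h' :=
  H.lift_fst _ _ _

end baseChange

end PointAction

section descent

/-- A flat surjective morphism that is quasi-compact or locally of finite presentation. -/
class IsFlatCover {S S' : Scheme.{u}} (π : S' ⟶ S) : Prop where
  flat : Flat π := by infer_instance
  surjective : Surjective π := by infer_instance
  quasiCompact_or : QuasiCompact π ∨ LocallyOfFinitePresentation π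

attribute [instance] IsFlatCover.flat IsFlatCover.surjective

namespace IsFlatCover

variable {S S' : Scheme.{u}}

instance of_quasiCompact (π : S' ⟶ S) [Flat π] [Surjective π] [QuasiCompact π] :
    IsFlatCover π where
  quasiCompact_or := .inl inferInstance

lemma of_locallyOfFinitePresentation (π : S' ⟶ S) [Flat π] [Surjective π]
    [LocallyOfFinitePresentation π] : IsFlatCover π where
  quasiCompact_or := .inr inferInstance

lemma of_isPullback {P X Y Z : Scheme.{u}} {fst : P ⟶ X} {snd : P ⟶ Y} {f : X ⟶ Z}
    {g : Y ⟶ Z} (H : IsPullback fst snd f g) [IsFlatCover g] : IsFlatCover fst where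
  flat := MorphismProperty.of_isPullback (P := @Flat) H.flip inferInstance
  surjective := MorphismProperty.of_isPullback (P := @Surjective) H.flip inferInstance
  quasiCompact_or := (quasiCompact_or (π := g)).imp
    (MorphismProperty.of_isPullback (P := @QuasiCompact) H.flip)
    (MorphismProperty.of_isPullback (P := @LocallyOfFinitePresentation) H.flip)

lemma epi (π : S' ⟶ S) [IsFlatCover π] : Epi π := Flat.epi_of_flat_of_surjective π

lemma effectiveEpi (π : S' ⟶ S) [IsFlatCover π] : EffectiveEpi π := by
  obtain h | h := quasiCompact_or (π := π) <;> infer_instance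

lemma isIso_of_isPullback {P X Y Z : Scheme.{u}} {fst : P ⟶ X} {snd : P ⟶ Y} {f : X ⟶ Z}
    {g : Y ⟶ Z} (H : IsPullback fst snd f g) [IsFlatCover f] [IsIso fst] : IsIso g := by
  obtain h | h := quasiCompact_or (π := f)
  · exact MorphismProperty.of_isPullback_of_descendsAlong
      (P := MorphismProperty.isomorphisms Scheme.{u})
      (Q := (@Surjective ⊓ @Flat ⊓ @QuasiCompact : MorphismProperty Scheme.{u})) H
      ⟨⟨inferInstance, inferInstance⟩, h⟩ ‹_›
  · exact MorphismProperty.of_isPullback_of_descendsAlong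
      (P := MorphismProperty.isomorphisms Scheme.{u})
      (Q := (@Surjective ⊓ @Flat ⊓ @LocallyOfFinitePresentation : MorphismProperty Scheme.{u})) H
      ⟨⟨inferInstance, inferInstance⟩, h⟩ ‹_›

end IsFlatCover

/-- If the left square and the outer rectangle are cartesian, and the bottom left morphism is a
flat cover, then the right square is cartesian. -/
lemma isPullback_of_isPullback_left {X₁ X₂ X₃ Y₁ Y₂ Y₃ : Scheme.{u}} {a : X₁ ⟶ X₂} {b : X₂ ⟶ X₃}
    {c : Y₁ ⟶ Y₂} {d : Y₂ ⟶ Y₃} {f₁ : X₁ ⟶ Y₁} {f₂ : X₂ ⟶ Y₂} {f₃ : X₃ ⟶ Y₃} [IsFlatCover c]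
    (h₁ : IsPullback a f₁ f₂ c) (h : IsPullback (a ≫ b) f₁ f₃ (c ≫ d)) (w : b ≫ f₃ = f₂ ≫ d) :
    IsPullback b f₂ f₃ d := by
  let l : X₂ ⟶ pullback f₃ d := pullback.lift b f₂ w
  have hl : l ≫ pullback.snd f₃ d = f₂ := pullback.lift_snd _ _ _
  let l' : X₁ ⟶ pullback (pullback.snd f₃ d) c := pullback.lift (a ≫ l) f₁ (by
    rw [Category.assoc, hl, h₁.w])
  have hl' : l' ≫ pullback.snd _ _ = f₁ := pullback.lift_snd _ _ _
  have H : IsPullback a l' l (pullback.fst (pullback.snd f₃ d) c) := by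
    refine IsPullback.of_bot (v₂₁ := pullback.snd _ _) (v₂₂ := pullback.snd _ _) (h₃₁ := c) ?_
      (pullback.lift_fst _ _ _).symm (IsPullback.of_hasPullback _ _)
    rwa [hl, hl']
  have big := (IsPullback.of_hasPullback (pullback.snd f₃ d) c).paste_horiz
    (IsPullback.of_hasPullback f₃ d)
  have : IsIso l' := by
    have : l' = (h.isoIsPullback _ _ big).hom := by
      apply big.hom_ext
      · rw [IsPullback.isoIsPullback_hom_fst, pullback.lift_fst_assoc, Category.assoc,
          pullback.lift_fst]
      · rw [IsPullback.isoIsPullback_hom_snd, hl']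
    rw [this]
    infer_instance
  have hfpqc : IsFlatCover (pullback.fst (pullback.snd f₃ d) c) :=
    .of_isPullback (IsPullback.of_hasPullback _ _)
  have : IsIso l := IsFlatCover.isIso_of_isPullback H.flip
  exact .of_iso_pullback ⟨w⟩ (asIso l) (pullback.lift_fst _ _ _) (pullback.lift_snd _ _ _)

end descent

namespace PointAction

variable {S S' X' : Scheme.{u}} {π : S' ⟶ S} {f : X' ⟶ S'} {A : PointAction π f}

namespace IsQuotient

variable {X : Scheme.{u}} {q : X' ⟶ X} {g : X ⟶ S}

lemma isFlatCover (hq : A.IsQuotient q g) [IsFlatCover π] : IsFlatCover q :=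
  .of_isPullback hq.isPullback

lemma epi (hq : A.IsQuotient q g) [IsFlatCover π] : Epi q :=
  have := hq.isFlatCover
  IsFlatCover.epi q

lemma eq_act (hq : A.IsQuotient q g) {T : Scheme.{u}} (x y : T ⟶ X') (h : x ≫ q = y ≫ q) :
    y = A.act x (y ≫ f) (by
      rw [← hq.isPullback.w, Category.assoc, ← hq.isPullback.w, reassoc_of% h]) := by
  apply hq.isPullback.hom_ext
  · rw [hq.isInvariant, h]
  · rw [A.act_comp]

/-- Invariant morphisms factor through the quotient. -/
lemma exists_desc (hq : A.IsQuotient q g) [IsFlatCover π] {Y : Scheme.{u}} (k : X' ⟶ Y)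
    (hk : A.IsInvariant k) : ∃ l : X ⟶ Y, q ≫ l = k := by
  have := hq.isFlatCover
  have := IsFlatCover.effectiveEpi q
  have hk' : ∀ {Z : Scheme.{u}} (a b : Z ⟶ X'), a ≫ q = b ≫ q → a ≫ k = b ≫ k := by
    intro Z a b h
    rw [hq.eq_act a b h, hk]
  exact ⟨EffectiveEpi.desc q k hk', EffectiveEpi.fac _ _ _⟩

end IsQuotient

/-- The existence of a quotient may be checked after refining the covering `π`. -/
lemma HasQuotient.of_baseChange [IsFlatCover π] {T' X'' : Scheme.{u}} {t : T' ⟶ S'} [IsFlatCover t]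
    {x'' : X'' ⟶ X'} {f'' : X'' ⟶ T'} (H : IsPullback x'' f'' f t)
    (h : (A.baseChange (π' := t ≫ π) (v := 𝟙 S) (by simp) H).HasQuotient) :
    A.HasQuotient := by
  obtain ⟨X, q, g, hq⟩ := h
  have hx : IsFlatCover x'' := .of_isPullback H
  have hepi : Epi x'' := IsFlatCover.epi x''
  have := IsFlatCover.effectiveEpi x''
  have hdesc : ∀ {Z : Scheme.{u}} (a b : Z ⟶ X''), a ≫ x'' = b ≫ x'' → a ≫ q = b ≫ q := by
    intro Z a b e
    have e₁ : a ≫ f'' ≫ t ≫ π = (b ≫ f'') ≫ t ≫ π := by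
      rw [Category.assoc, ← H.w_assoc, reassoc_of% e]
    rw [← hq.isInvariant a (b ≫ f'') e₁]
    congr 1
    apply H.hom_ext
    · rw [baseChange_act_fst, A.act_self, e]
      · rw [Category.assoc, Category.assoc, ← H.w, reassoc_of% e]
      · rw [Category.assoc, H.w_assoc, e₁, Category.assoc, Category.assoc, Category.assoc]
    · rw [PointAction.act_comp]
  let q' : X' ⟶ X := EffectiveEpi.desc x'' q hdesc
  have hq' : x'' ≫ q' = q := EffectiveEpi.fac _ _ _
  have hw : q' ≫ g = f ≫ π := by
    rw [← cancel_epi x'', reassoc_of% hq', hq.isPullback.w, H.w_assoc]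
  refine ⟨X, q', g, ?_, ?_⟩
  · refine isPullback_of_isPullback_left H ?_ hw
    rw [hq']
    exact hq.isPullback
  · intro T x s h
    let a : pullback x x'' ⟶ T := pullback.fst _ _
    let b : pullback (a ≫ s) t ⟶ T := pullback.fst _ _ ≫ a
    have : IsFlatCover a := .of_isPullback (IsPullback.of_hasPullback x x'')
    have : IsFlatCover (pullback.fst (a ≫ s) t) :=
      .of_isPullback (IsPullback.of_hasPullback (a ≫ s) t)
    have : Epi a := IsFlatCover.epi a
    have : Epi (pullback.fst (a ≫ s) t) := IsFlatCover.epi _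
    have : Epi b := epi_comp _ _
    let y : pullback (a ≫ s) t ⟶ X'' := pullback.fst _ _ ≫ pullback.snd _ _
    let r : pullback (a ≫ s) t ⟶ T' := pullback.snd _ _
    have hy : y ≫ x'' = b ≫ x := by
      simp only [y, b, a, Category.assoc, pullback.condition]
    have hr : r ≫ t = b ≫ s := by
      simp only [r, b, Category.assoc, ← pullback.condition]
    have e₃ : y ≫ f'' ≫ t ≫ π = r ≫ t ≫ π := by
      rw [← H.w_assoc, reassoc_of% hy, h, reassoc_of% hr]
    have e₄ := hq.isInvariant y r e₃
    have e₅ : (y ≫ x'') ≫ f ≫ π = (r ≫ t) ≫ π := by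
      rw [Category.assoc, H.w_assoc, e₃, Category.assoc]
    rw [← hq', ← Category.assoc, ← Category.assoc, baseChange_act_fst (h' := e₅),
      A.act_congr hy hr] at e₄
    rw [← cancel_epi b, ← Category.assoc,
      A.comp_act _ _ _ _ (by simp only [Category.assoc, h]), e₄, hy, Category.assoc]

end PointAction

open TensorProduct in
lemma exists_isPushout_of_coequalizing {R R' C D E : CommRingCat.{u}} {ρ : R ⟶ R'} {γ : R ⟶ C}
    {u v : C ⟶ D} {i : R' ⟶ D} (hv : IsPushout ρ γ i v) (hu : γ ≫ u = γ ≫ v) {α : D ⟶ E}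
    {β : R' ⟶ E} (h : IsPushout ρ (γ ≫ v) β α) {u' v' : D ⟶ E} (hu₁ : v ≫ u' = u ≫ α)
    (hu₂ : i ≫ u' = β) (hv₁ : v ≫ v' = v ≫ α) (hv₂ : i ≫ v' = β) {φ : R' ⟶ C} (hφ : ρ ≫ φ = γ)
    (hφu : φ ≫ u = i) (hinj : Function.Injective u) (huv : u ≫ u' = u ≫ v') (hρ : ρ.hom.Flat) :
    ∃ (B : CommRingCat.{u}) (κ : R ⟶ B) (η : B ⟶ C),
      IsPushout ρ κ φ η ∧ η ≫ u = η ≫ v := by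
  algebraize [ρ.hom, γ.hom, (γ ≫ v).hom]
  let uA : C →ₐ[R] D := ⟨u.hom, fun r ↦ congr($hu r)⟩
  let vA : C →ₐ[R] D := ⟨v.hom, fun r ↦ rfl⟩
  let θC := (CommRingCat.isPushout_tensorProduct R R' C).isoIsPushout R' C hv
  let θD := (CommRingCat.isPushout_tensorProduct R R' D).isoIsPushout R' D h
  have hC : ∀ (r : R') (c : C), θC.hom (r ⊗ₜ[R] c) = i r * v c := by
    intro r c
    have h₁ : θC.hom (r ⊗ₜ[R] (1 : C)) = i r := congr($((CommRingCat.isPushout_tensorProduct R R'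
      C).inl_isoIsPushout_hom R' C hv) r)
    have h₂ : θC.hom ((1 : R') ⊗ₜ[R] c) = v c := congr($((CommRingCat.isPushout_tensorProduct R R'
      C).inr_isoIsPushout_hom R' C hv) c)
    rw [← h₁, ← h₂, ← map_mul, Algebra.TensorProduct.tmul_mul_tmul, mul_one, one_mul]
  have hD : ∀ (r : R') (c : D), θD.hom (r ⊗ₜ[R] c) = β r * α c := by
    intro r c
    have h₁ : θD.hom (r ⊗ₜ[R] (1 : D)) = β r := congr($((CommRingCat.isPushout_tensorProduct R R'
      D).inl_isoIsPushout_hom R' D h) r)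
    have h₂ : θD.hom ((1 : R') ⊗ₜ[R] c) = α c := congr($((CommRingCat.isPushout_tensorProduct R R'
      D).inr_isoIsPushout_hom R' D h) c)
    rw [← h₁, ← h₂, ← map_mul, Algebra.TensorProduct.tmul_mul_tmul, mul_one, one_mul]
  have θCinj : Function.Bijective θC.hom := ConcreteCategory.bijective_of_isIso θC.hom
  have θDinj : Function.Bijective θD.hom := ConcreteCategory.bijective_of_isIso θD.hom
  have natu : ∀ x : R' ⊗[R] C,
      θD.hom (Algebra.TensorProduct.map (AlgHom.id R' R') uA x) = u' (θC.hom x) := by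
    intro x
    induction x with
    | zero => simp only [map_zero]
    | add x y hx hy => simp only [map_add, hx, hy]
    | tmul r c =>
      rw [Algebra.TensorProduct.map_tmul, hC, hD, map_mul, ← hu₂]
      congr 1
      exact congr($hu₁ c).symm
  have natv : ∀ x : R' ⊗[R] C,
      θD.hom (Algebra.TensorProduct.map (AlgHom.id R' R') vA x) = v' (θC.hom x) := by
    intro x
    induction x with
    | zero => simp only [map_zero]
    | add x y hx hy => simp only [map_add, hx, hy]
    | tmul r c =>
      rw [Algebra.TensorProduct.map_tmul, hC, hD, map_mul, ← hv₂]
      congr 1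
      exact congr($hv₁ c).symm
  let φA : R' →ₐ[R] C := ⟨φ.hom, fun r ↦ congr($hφ r)⟩
  let B := AlgHom.equalizer uA vA
  let ψ : R' ⊗[R] B →ₐ[R] C := Algebra.TensorProduct.productMap φA B.val
  have hψ : ∀ x, u (ψ x) = θC.hom (Algebra.TensorProduct.map (AlgHom.id R' R') B.val x) := by
    intro x
    induction x with
    | zero => simp only [map_zero]
    | add x y hx hy => simp only [map_add, hx, hy]
    | tmul r c =>
      rw [Algebra.TensorProduct.map_tmul, hC, Algebra.TensorProduct.productMap_apply_tmul, map_mul]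
      congr 1
      · exact congr($hφu r)
      · exact c.2
  have hbij : Function.Bijective ψ := by
    refine ⟨fun x y hxy ↦ ?_, fun c ↦ ?_⟩
    · have h₁ := congrArg u hxy
      rw [hψ, hψ] at h₁
      exact Module.Flat.lTensor_preserves_injective_linearMap (M := R') B.val.toLinearMap
        Subtype.val_injective (θCinj.1 h₁)
    · obtain ⟨x, hx⟩ := θCinj.2 (u c)
      have hx' : x ∈ AlgHom.equalizer (Algebra.TensorProduct.map (AlgHom.id R' R') uA)
          (Algebra.TensorProduct.map (AlgHom.id R' R') vA) := by
        apply θDinj.1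
        rw [natu, natv, hx]
        exact congr($huv c)
      obtain ⟨z, hz⟩ := (AlgHom.tensorEqualizerEquiv R' R' uA vA).surjective ⟨x, hx'⟩
      refine ⟨z, hinj ?_⟩
      rw [hψ, ← hx]
      congr 1
      have := congrArg Subtype.val hz
      rwa [AlgHom.tensorEqualizerEquiv_apply, AlgHom.coe_tensorEqualizer] at this
  refine ⟨CommRingCat.of B, CommRingCat.ofHom (algebraMap R B), CommRingCat.ofHom B.val.toRingHom,
    ?_, ?_⟩
  · refine (CommRingCat.isPushout_tensorProduct R R' B).of_iso (Iso.refl _) (Iso.refl _)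
      (Iso.refl _) (RingEquiv.ofBijective ψ.toRingHom hbij).toCommRingCatIso ?_ ?_ ?_ ?_
    · rfl
    · rfl
    · ext r
      change ψ (r ⊗ₜ 1) = φ r
      rw [Algebra.TensorProduct.productMap_apply_tmul, map_one, mul_one]
      rfl
    · ext b
      change ψ (1 ⊗ₜ b) = b.1
      rw [Algebra.TensorProduct.productMap_apply_tmul, map_one, one_mul]
      rfl
  · ext b
    exact b.2

/-- Flat base change for global sections of quasi-compact quasi-separated schemes. -/
lemma isPushout_appTop {S T X Y : Scheme.{u}} {f : T ⟶ S} {g : Y ⟶ X} {iX : X ⟶ S} {iY : Y ⟶ T}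
    (H : IsPullback g iY iX f) [IsAffine S] [IsAffine T] [Flat f] [CompactSpace X]
    [QuasiSeparatedSpace X] : IsPushout iX.appTop f.appTop g.appTop iY.appTop := by
  have key {A B : Scheme.{u}} (k : A ⟶ B) (h : (⊤ : A.Opens) ≤ k ⁻¹ᵁ ⊤) :
      k.appLE ⊤ ⊤ h = k.appTop := k.appLE_eq_app
  have hX : (⊤ : X.Opens) ≤ iX ⁻¹ᵁ ⊤ := le_top
  have hT : (⊤ : T.Opens) ≤ f ⁻¹ᵁ ⊤ := le_top
  have hY : (⊤ : Y.Opens) = g ⁻¹ᵁ ⊤ ⊓ iY ⁻¹ᵁ ⊤ := by simp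
  rw [← key iX hX, ← key f hT, ← key g le_top, ← key iY le_top]
  exact (isIso_pushoutSection_iff H hT hX hY).mp
    (isIso_pushoutSection_of_isQuasiSeparated_of_flat_right H hT hX hY (isAffineOpen_top S)
      (isAffineOpen_top T) isCompact_univ isQuasiSeparated_univ)

namespace PointAction

variable {S S' X' : Scheme.{u}} {π : S' ⟶ S} {f : X' ⟶ S'} {A : PointAction π f}

/-- Descent for open subschemes of a base change. -/
lemma HasQuotient.of_isOpenImmersion [IsFlatCover π] [QuasiCompact π] {Z Z' : Scheme.{u}}
    {h : Z' ⟶ Z} {k' : Z' ⟶ S'}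
    {k : Z ⟶ S} (H : IsPullback h k' k π) (j : X' ⟶ Z') [IsOpenImmersion j] (hj : j ≫ k' = f)
    (hinv : A.IsInvariant (j ≫ h)) : A.HasQuotient := by
  have := IsFlatCover.of_isPullback H
  have := MorphismProperty.of_isPullback (P := @QuasiCompact) H.flip inferInstance
  let m : pullback (f ≫ π) π ⟶ X' := A.act (pullback.fst _ _) (pullback.snd _ _) pullback.condition
  have Hm : IsPullback (m ≫ j) (pullback.fst (f ≫ π) π) h (j ≫ h) := by
    refine IsPullback.of_right (h₁₂ := k') (h₂₂ := k) (v₁₃ := π) ?_ ?_ H.flip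
    · rw [Category.assoc, Category.assoc, H.w, hj, reassoc_of% hj, A.act_comp]
      exact (IsPullback.of_hasPullback _ _).flip
    · rw [Category.assoc, hinv]
  have hsat : h ⁻¹' (Set.range (j ≫ h)) = Set.range j := by
    ext z
    constructor
    · rintro ⟨x, hx⟩
      obtain ⟨w, hw, -⟩ := Scheme.exists_preimage_of_isPullback Hm z x hx.symm
      rw [Scheme.Hom.comp_apply] at hw
      exact ⟨m w, hw⟩
    · rintro ⟨x, rfl⟩
      exact ⟨x, by rw [Scheme.Hom.comp_apply]⟩
  let U : Z.Opens := ⟨Set.range (j ≫ h), by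
    rw [← (Flat.isQuotientMap_of_surjective h).isOpen_preimage, hsat]
    exact j.isOpenEmbedding.isOpen_range⟩
  let q : X' ⟶ U := IsOpenImmersion.lift U.ι (j ≫ h) (by rw [Scheme.Opens.range_ι]; rfl)
  have hq : q ≫ U.ι = j ≫ h := IsOpenImmersion.lift_fac _ _ _
  have Hq : IsPullback q j U.ι h := by
    refine IsOpenImmersion.isPullback _ _ _ _ hq.symm ?_
    rw [Scheme.Opens.opensRange_ι]
    exact TopologicalSpace.Opens.ext hsat
  refine ⟨U, q, U.ι ≫ k, ?_, ?_⟩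
  · rw [← hj]
    exact (Hq.flip.paste_horiz H.flip).flip
  · intro T x s e
    rw [← cancel_mono U.ι, Category.assoc, Category.assoc, hq, hinv]

lemma hasQuotient_of_isOpenImmersion [IsFlatCover π] [QuasiCompact π]
    (A : PointAction π f) [IsOpenImmersion f] :
    A.HasQuotient := by
  refine .of_isOpenImmersion (h := π) (k' := 𝟙 S') (k := 𝟙 S) (IsPullback.of_id_snd) f
    (Category.comp_id f) ?_
  intro T x s h
  rw [reassoc_of% A.act_comp, h]

/-- Transport over the universal pair of points. -/
noncomputable def univAct (A : PointAction π f) : pullback (f ≫ π) π ⟶ X' :=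
  A.act (pullback.fst _ _) (pullback.snd _ _) pullback.condition

lemma act_eq_lift_univAct (A : PointAction π f) {T : Scheme.{u}} (x : T ⟶ X') (s : T ⟶ S')
    (h : x ≫ f ≫ π = s ≫ π) : A.act x s h = pullback.lift x s h ≫ A.univAct := by
  rw [univAct, A.comp_act]
  exact A.act_congr (pullback.lift_fst _ _ _).symm (pullback.lift_snd _ _ _).symm _

lemma univAct_comp (A : PointAction π f) : A.univAct ≫ f = pullback.snd _ _ := A.act_comp _ _ _

lemma isInvariant_iff (A : PointAction π f) {X : Scheme.{u}} (q : X' ⟶ X) :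
    A.IsInvariant q ↔ A.univAct ≫ q = pullback.fst _ _ ≫ q := by
  refine ⟨fun h ↦ h _ _ _, fun h T x s e ↦ ?_⟩
  rw [act_eq_lift_univAct, Category.assoc, h, pullback.lift_fst_assoc]

/-- Effective descent for quasi-affine schemes over affine bases. -/
lemma hasQuotient_of_isQuasiAffine [IsFlatCover π] [QuasiCompact π]
    (A : PointAction π f) [IsAffine S] [IsAffine S']
    [X'.IsQuasiAffine] : A.HasQuotient := by
  let W := pullback (f ≫ π) π
  have : IsAffineHom (pullback.fst (f ≫ π) π) :=
    MorphismProperty.of_isPullback (P := @IsAffineHom) (IsPullback.of_hasPullback _ π).flip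
      inferInstance
  have : W.IsQuasiAffine := Scheme.IsQuasiAffine.of_isAffineHom (pullback.fst (f ≫ π) π)
  have e₀ : A.univAct ≫ f ≫ π = pullback.fst (f ≫ π) π ≫ f ≫ π := by
    rw [← Category.assoc, univAct_comp, pullback.condition]
  let W₂ := pullback (pullback.fst (f ≫ π) π ≫ f ≫ π) π
  let a : W₂ ⟶ W := pullback.fst _ _
  let b : W₂ ⟶ S' := pullback.snd _ _
  have hab : a ≫ pullback.fst (f ≫ π) π ≫ f ≫ π = b ≫ π := pullback.condition
  let M : W₂ ⟶ W := pullback.lift (a ≫ A.univAct) b (by rw [Category.assoc, e₀, hab])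
  let N : W₂ ⟶ W := pullback.lift (a ≫ pullback.fst _ _) b (by rw [Category.assoc, hab])
  have hMN : M ≫ A.univAct = N ≫ A.univAct := by
    rw [← act_eq_lift_univAct, ← act_eq_lift_univAct]
    have e₁ : a ≫ A.univAct = A.act (a ≫ pullback.fst _ _) (a ≫ pullback.snd _ _)
        (by rw [Category.assoc, Category.assoc, pullback.condition (f := f ≫ π)]) :=
      A.comp_act _ _ _ _ _
    rw [A.act_congr e₁ rfl, A.act_act]
  let e : X' ⟶ W := pullback.lift (𝟙 X') f (Category.id_comp _)
  have he : e ≫ A.univAct = 𝟙 X' := by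
    rw [← act_eq_lift_univAct, A.act_self]
    exact Category.id_comp _
  obtain ⟨B, κ, η, HB, hη⟩ := exists_isPushout_of_coequalizing
    (ρ := π.appTop) (γ := (f ≫ π).appTop) (u := A.univAct.appTop)
    (v := (pullback.fst (f ≫ π) π).appTop) (i := (pullback.snd (f ≫ π) π).appTop)
    (α := a.appTop) (β := b.appTop) (u' := M.appTop) (v' := N.appTop) (φ := f.appTop)
    (isPushout_appTop (IsPullback.of_hasPullback (f ≫ π) π)).flip
    (by rw [← Scheme.Hom.comp_appTop, ← Scheme.Hom.comp_appTop, e₀])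
    (by
      rw [← Scheme.Hom.comp_appTop]
      exact (isPushout_appTop (IsPullback.of_hasPullback
        (pullback.fst (f ≫ π) π ≫ f ≫ π) π)).flip)
    (by rw [← Scheme.Hom.comp_appTop, ← Scheme.Hom.comp_appTop, pullback.lift_fst])
    (by rw [← Scheme.Hom.comp_appTop, pullback.lift_snd])
    (by rw [← Scheme.Hom.comp_appTop, ← Scheme.Hom.comp_appTop, pullback.lift_fst])
    (by rw [← Scheme.Hom.comp_appTop, pullback.lift_snd])
    (by rw [← Scheme.Hom.comp_appTop])
    (by rw [← Scheme.Hom.comp_appTop, univAct_comp])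
    (Function.LeftInverse.injective (g := e.appTop) fun x ↦ by
      have := congr($(congrArg Scheme.Hom.appTop he) x)
      rwa [Scheme.Hom.comp_appTop, Scheme.Hom.id_appTop] at this)
    (by rw [← Scheme.Hom.comp_appTop, ← Scheme.Hom.comp_appTop, hMN])
    π.flat_appTop
  refine .of_isOpenImmersion (h := Spec.map η) (k' := Spec.map f.appTop ≫ S'.isoSpec.inv)
    (k := Spec.map κ ≫ S.isoSpec.inv) ?_ X'.toSpecΓ ?_ ?_
  · refine (isPullback_SpecMap_of_isPushout _ _ _ _ HB).flip.of_iso (Iso.refl _) (Iso.refl _)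
      S'.isoSpec.symm S.isoSpec.symm ?_ ?_ ?_ ?_
    all_goals simp [Scheme.isoSpec_inv_naturality]
  · rw [← Category.assoc, ← Scheme.toSpecΓ_naturality]
    simp [Scheme.isoSpec]
  · rw [isInvariant_iff]
    have h₁ := Scheme.toSpecΓ_naturality A.univAct
    have h₂ := Scheme.toSpecΓ_naturality (pullback.fst (f ≫ π) π)
    rw [reassoc_of% h₁, reassoc_of% h₂, ← Spec.map_comp, ← Spec.map_comp, hη]

end PointAction
namespace PointAction

section gluing

variable {S S' X' : Scheme.{u}} {π : S' ⟶ S} {f : X' ⟶ S'} (A : PointAction π f)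

/-- The restriction of an action along `v : V ⟶ S`. -/
noncomputable def restrict {V : Scheme.{u}} (v : V ⟶ S) :
    PointAction (pullback.snd π v) (pullback.snd f (pullback.fst π v)) :=
  A.baseChange pullback.condition (IsPullback.of_hasPullback f (pullback.fst π v))

lemma restrict_act_fst {V T : Scheme.{u}} (v : V ⟶ S) (y : T ⟶ pullback f (pullback.fst π v))
    (s : T ⟶ pullback π v) (h : y ≫ pullback.snd _ _ ≫ pullback.snd π v = s ≫ pullback.snd π v)
    (h' : (y ≫ pullback.fst _ _) ≫ f ≫ π = (s ≫ pullback.fst _ _) ≫ π) :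
    (A.restrict v).act y s h ≫ pullback.fst _ _ =
      A.act (y ≫ pullback.fst _ _) (s ≫ pullback.fst _ _) h' :=
  A.baseChange_act_fst pullback.condition (IsPullback.of_hasPullback f (pullback.fst π v)) _ _ _ _

variable {V W : Scheme.{u}} {v : V ⟶ S} {w : W ⟶ S} (r : V ⟶ W) (hr : r ≫ w = v)

/-- The transition morphism between the restrictions of the covering. -/
noncomputable def transBase (π : S' ⟶ S) : pullback π v ⟶ pullback π w :=
  pullback.map π v π w (𝟙 S') r (𝟙 S) (by simp) (by simp [hr])

/-- The transition morphism between the restrictions of `X'`. -/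
noncomputable def trans (π : S' ⟶ S) (f : X' ⟶ S') :
    pullback f (pullback.fst π v) ⟶ pullback f (pullback.fst π w) :=
  pullback.map _ _ _ _ (𝟙 X') (transBase r hr π) (𝟙 S') (by simp)
    ((Category.comp_id _).trans ((pullback.lift_fst _ _ _).trans (Category.comp_id _)).symm)

lemma transBase_fst : transBase r hr π ≫ pullback.fst π w = pullback.fst π v :=
  (pullback.lift_fst _ _ _).trans (Category.comp_id _)

lemma transBase_snd : transBase r hr π ≫ pullback.snd π w = pullback.snd π v ≫ r :=
  pullback.lift_snd _ _ _

lemma trans_fst : trans r hr π f ≫ pullback.fst _ _ = pullback.fst _ _ :=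
  (pullback.lift_fst _ _ _).trans (Category.comp_id _)

lemma trans_snd : trans r hr π f ≫ pullback.snd _ _ = pullback.snd _ _ ≫ transBase r hr π :=
  pullback.lift_snd _ _ _

lemma isPullback_trans : IsPullback (trans r hr π f) (pullback.snd f (pullback.fst π v))
    (pullback.snd f (pullback.fst π w)) (transBase r hr π) := by
  refine IsPullback.of_right (h₁₂ := pullback.fst _ _) (h₂₂ := pullback.fst _ _) (v₁₃ := f) ?_
    (trans_snd r hr) (IsPullback.of_hasPullback _ _)
  rw [trans_fst, transBase_fst]
  exact IsPullback.of_hasPullback _ _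

variable {A} {r}

/-- Quotients of restrictions along `V ⟶ W` are related by base change. -/
lemma exists_isPullback_trans [IsFlatCover π] {X Y : Scheme.{u}}
    {q : pullback f (pullback.fst π v) ⟶ X} {g : X ⟶ V} (hq : (A.restrict v).IsQuotient q g)
    {p : pullback f (pullback.fst π w) ⟶ Y} {k : Y ⟶ W} (hp : (A.restrict w).IsQuotient p k) :
    ∃ t : X ⟶ Y, q ≫ t = trans r hr π f ≫ p ∧ IsPullback t g k r := by
  have : IsFlatCover (pullback.snd π v) :=
    .of_isPullback (IsPullback.of_hasPullback π v).flip
  obtain ⟨t, ht⟩ := hq.exists_desc (trans r hr π f ≫ p) (by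
    intro T x s h
    have h₁ : (x ≫ trans r hr π f) ≫ pullback.snd _ _ ≫ pullback.snd π w =
        (s ≫ transBase r hr π) ≫ pullback.snd π w := by
      rw [Category.assoc, Category.assoc, reassoc_of% (trans_snd (π := π) (f := f) r hr),
        transBase_snd, reassoc_of% h]
    have h₂ : (x ≫ pullback.fst _ _) ≫ f ≫ π = (s ≫ pullback.fst _ _) ≫ π := by
      rw [Category.assoc, pullback.condition_assoc, pullback.condition, reassoc_of% h,
        Category.assoc, pullback.condition]
    have h₃ : ((x ≫ trans r hr π f) ≫ pullback.fst _ _) ≫ f ≫ π =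
        ((s ≫ transBase r hr π) ≫ pullback.fst _ _) ≫ π := by
      rw [Category.assoc x, trans_fst, h₂, Category.assoc s (transBase r hr π), transBase_fst]
    have key : (A.restrict v).act x s h ≫ trans r hr π f =
        (A.restrict w).act (x ≫ trans r hr π f) (s ≫ transBase r hr π) h₁ := by
      apply pullback.hom_ext
      · rw [Category.assoc, trans_fst, A.restrict_act_fst v x s h h₂,
          A.restrict_act_fst w _ _ h₁ h₃]
        refine A.act_congr ?_ ?_ _
        · rw [Category.assoc, trans_fst]
        · rw [Category.assoc, transBase_fst]
      · rw [Category.assoc, trans_snd, reassoc_of% (A.restrict v).act_comp,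
          (A.restrict w).act_comp]
    rw [reassoc_of% key, hp.isInvariant, Category.assoc])
  have hepi := hq.epi
  refine ⟨t, ht, ?_⟩
  refine isPullback_of_isPullback_left hq.isPullback ?_ ?_
  · rw [ht, ← transBase_snd r hr]
    exact (isPullback_trans r hr).paste_horiz hp.isPullback
  · rw [← cancel_epi q, reassoc_of% ht, hp.isPullback.w, reassoc_of% (trans_snd (π := π) r hr),
      transBase_snd, hq.isPullback.w_assoc]

open Scheme in
/-- Quotients over the members of a locally directed open cover glue. -/
lemma hasQuotient_of_relativeGluingData (𝒰 : S.OpenCover) [Category.{u} 𝒰.I₀]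
    [𝒰.LocallyDirected] [Small.{u} 𝒰.I₀] [Quiver.IsThin 𝒰.I₀] (d : 𝒰.RelativeGluingData)
    (q : ∀ i, pullback f (pullback.fst π (𝒰.f i)) ⟶ d.functor.obj i)
    (hq : ∀ i, (A.restrict (𝒰.f i)).IsQuotient (q i) (d.natTrans.app i))
    (ht : ∀ {i j : 𝒰.I₀} (a : i ⟶ j),
      q i ≫ d.functor.map a = trans (𝒰.trans a) (𝒰.trans_map a) π f ≫ q j) :
    A.HasQuotient := by
  let 𝒱 : X'.OpenCover := (𝒰.pullback₁ π).pullback₁ f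
  let Q : X' ⟶ d.glued := 𝒱.glueMorphismsOfLocallyDirected
    (fun i ↦ q i ≫ colimit.ι d.functor i) (by
      intro i j a
      refine Eq.trans ?_ (congrArg (q i ≫ ·) (colimit.w d.functor a))
      refine Eq.trans ?_ ((reassoc_of% ht a) _).symm
      rfl)
  have hQ (i : 𝒰.I₀) : pullback.fst f (pullback.fst π (𝒰.f i)) ≫ Q =
      q i ≫ colimit.ι d.functor i :=
    OpenCover.map_glueMorphismsOfLocallyDirected 𝒱 _ _ i
  refine ⟨d.glued, Q, d.toBase, ?_, ?_⟩
  · refine (isPullback_of_openCover f Q π d.toBase (𝒰.pullback₁ π) fun (i : 𝒰.I₀) ↦ ?_).flip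
    have h₁ := (hq i).isPullback.flip.paste_vert (d.isPullback_natTrans_ι_toBase i)
    have h₂ : pullback.fst π (𝒰.f i) ≫ π = pullback.snd π (𝒰.f i) ≫ 𝒰.f i := pullback.condition
    rw [← hQ, ← h₂] at h₁
    exact h₁
  · intro T x s h
    refine Cover.hom_ext (𝒰.pullback₁ (s ≫ π)) _ _ fun (i : 𝒰.I₀) ↦ ?_
    let c : pullback (s ≫ π) (𝒰.f i) ⟶ T := pullback.fst _ _
    let p : pullback (s ≫ π) (𝒰.f i) ⟶ 𝒰.X i := pullback.snd _ _
    have hcp : c ≫ s ≫ π = p ≫ 𝒰.f i := pullback.condition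
    let s' : pullback (s ≫ π) (𝒰.f i) ⟶ pullback π (𝒰.f i) :=
      pullback.lift (c ≫ s) p (by rw [Category.assoc, hcp])
    let x' : pullback (s ≫ π) (𝒰.f i) ⟶ pullback f (pullback.fst π (𝒰.f i)) :=
      pullback.lift (c ≫ x) (pullback.lift (c ≫ x ≫ f) p (by
        rw [Category.assoc, Category.assoc, h, hcp])) (by rw [pullback.lift_fst, Category.assoc])
    have hx' : x' ≫ pullback.fst _ _ = c ≫ x := pullback.lift_fst _ _ _
    have hs' : s' ≫ pullback.fst _ _ = c ≫ s := pullback.lift_fst _ _ _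
    have h₁ : x' ≫ pullback.snd _ _ ≫ pullback.snd π (𝒰.f i) = s' ≫ pullback.snd π (𝒰.f i) := by
      rw [pullback.lift_snd_assoc, pullback.lift_snd, pullback.lift_snd]
    have h₂ : (x' ≫ pullback.fst _ _) ≫ f ≫ π = (s' ≫ pullback.fst _ _) ≫ π := by
      rw [hx', hs', Category.assoc, h, Category.assoc]
    have h₃ := A.restrict_act_fst (𝒰.f i) x' s' h₁ h₂
    rw [A.act_congr hx' hs', ← A.comp_act c x s h] at h₃
    change c ≫ A.act x s h ≫ Q = c ≫ x ≫ Q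
    rw [← reassoc_of% h₃, hQ, ← Category.assoc, (hq i).isInvariant, Category.assoc, ← hQ,
      reassoc_of% hx']

open Scheme in
/-- The existence of quotients is local on the base. -/
lemma HasQuotient.of_openCover [IsFlatCover π] (𝒰 : S.OpenCover) [Category.{u} 𝒰.I₀]
    [𝒰.LocallyDirected] [Small.{u} 𝒰.I₀] [Quiver.IsThin 𝒰.I₀]
    (H : ∀ i, (A.restrict (𝒰.f i)).HasQuotient) : A.HasQuotient := by
  choose X q g hq using H
  have hcov (i : 𝒰.I₀) : IsFlatCover (pullback.snd π (𝒰.f i)) :=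
    .of_isPullback (IsPullback.of_hasPullback π (𝒰.f i)).flip
  have hepi (i : 𝒰.I₀) : Epi (q i) := (hq i).epi
  have ht {i j : 𝒰.I₀} (a : i ⟶ j) :=
    exists_isPullback_trans (r := 𝒰.trans a) (𝒰.trans_map a) (hq i) (hq j)
  choose t ht₁ ht₂ using @ht
  let F : 𝒰.I₀ ⥤ Scheme.{u} :=
    { obj := X
      map := t
      map_id := fun i ↦ by
        rw [← cancel_epi (q i), ht₁]
        have : trans (𝒰.trans (𝟙 i)) (𝒰.trans_map (𝟙 i)) π f = 𝟙 _ := by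
          apply pullback.hom_ext
          · rw [trans_fst, Category.id_comp]
          · rw [trans_snd, Category.id_comp]
            refine Eq.trans ?_ (Category.comp_id _)
            congr 1
            apply pullback.hom_ext
            · rw [transBase_fst, Category.id_comp]
            · rw [transBase_snd, Cover.trans_id, Category.id_comp, Category.comp_id]
        rw [this, Category.id_comp, Category.comp_id]
      map_comp := fun {i j k} a b ↦ by
        rw [← cancel_epi (q i), ht₁, reassoc_of% ht₁ a, ht₁ b, ← Category.assoc]
        congr 1
        apply pullback.hom_ext
        · rw [Category.assoc, trans_fst, trans_fst, trans_fst]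
        · rw [Category.assoc, trans_snd, trans_snd, reassoc_of% (trans_snd (π := π) (f := f))]
          congr 1
          apply pullback.hom_ext
          · rw [Category.assoc, transBase_fst, transBase_fst, transBase_fst]
          · rw [Category.assoc, transBase_snd, transBase_snd, reassoc_of% (transBase_snd (π := π)),
              Cover.trans_comp] }
  let d : 𝒰.RelativeGluingData :=
    { functor := F
      natTrans := { app := g, naturality := fun i j a ↦ (ht₂ a).w }
      equifibered := fun i j a ↦ ht₂ a }
  exact hasQuotient_of_relativeGluingData 𝒰 d q hq ht₁

end gluing
end PointAction

/-- A quasi-compact scheme covered by quasi-affine basic opens of global sections is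
quasi-affine. -/
lemma isQuasiAffine_of_forall_exists_basicOpen (X : Scheme.{u}) [CompactSpace X]
    (H : ∀ x : X, ∃ r : Γ(X, ⊤), (X.basicOpen r).toScheme.IsQuasiAffine ∧ x ∈ X.basicOpen r) :
    X.IsQuasiAffine := by
  have : QuasiSeparatedSpace X := by
    choose r hr hxr using H
    refine .of_isOpenCover (U := (X.basicOpen <| r ·))
      (eq_top_iff.mpr fun _ _ ↦ TopologicalSpace.Opens.mem_iSup.mpr ⟨_, hxr _⟩)
      (fun _ ↦ isRetrocompact_basicOpen _) (fun x ↦ ?_)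
    have := hr x
    rw [isQuasiSeparated_iff_quasiSeparatedSpace _ (X.basicOpen (r x)).isOpen]
    exact inferInstanceAs (QuasiSeparatedSpace (X.basicOpen (r x)).toScheme)
  refine .of_forall_exists_mem_basicOpen X fun x ↦ ?_
  obtain ⟨r, hr, hxr⟩ := H x
  obtain ⟨_, ⟨_, ⟨a, ha, rfl⟩, rfl⟩, hxa, -⟩ := (Scheme.IsQuasiAffine.isBasis_basicOpen
    (X.basicOpen r).toScheme).exists_subset_of_mem_open (Set.mem_univ (⟨x, hxr⟩ : X.basicOpen r))
    isOpen_univ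
  have := isLocalization_basicOpen_of_qcqs isCompact_univ isQuasiSeparated_univ r
  let b : Γ(X, X.basicOpen r) := (X.basicOpen r).topIso.hom a
  obtain ⟨n, s, hs⟩ := IsLocalization.Away.surj r b
  have hb : (X.basicOpen r).ι ''ᵁ ((X.basicOpen r).toScheme.basicOpen a) = X.basicOpen b := by
    exact Scheme.Opens.ι_image_basicOpen' (X.basicOpen r) a
  have hrs : X.basicOpen (r * s) = X.basicOpen b := by
    have h₁ : X.presheaf.map (homOfLE (X.basicOpen_le r)).op s =
      b * X.presheaf.map (homOfLE (X.basicOpen_le r)).op r ^ n := hs.symm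
    have h₂ : IsUnit (X.presheaf.map (homOfLE (X.basicOpen_le r)).op r) :=
      RingedSpace.isUnit_res_basicOpen _ r
    have h₃ := congrArg X.basicOpen h₁
    rw [Scheme.basicOpen_res, Scheme.basicOpen_mul, Scheme.basicOpen_of_isUnit _ (h₂.pow n),
      inf_eq_left.mpr (X.basicOpen_le b)] at h₃
    rw [Scheme.basicOpen_mul, h₃]
  refine ⟨r * s, ?_, ?_⟩
  · rw [hrs, ← hb]
    exact ha.image_of_isOpenImmersion _
  · rw [hrs, ← hb]
    exact ⟨_, hxa, rfl⟩

instance (priority := low) {X Y : Scheme.{u}} (f : X ⟶ Y) [IsAffineHom f] :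
    IsQuasiAffineHom f where
  isQuasiAffine_preimage U hU := by
    have : IsAffine (f ⁻¹ᵁ U).toScheme := hU.preimage f
    infer_instance

instance (priority := low) {X Y : Scheme.{u}} (f : X ⟶ Y) [IsQuasiAffineHom f] :
    QuasiCompact f := by
  refine quasiCompact_iff_forall_isAffineOpen.mpr fun U hU ↦ ?_
  have := IsQuasiAffineHom.isQuasiAffine_preimage (f := f) U hU
  exact isCompact_iff_compactSpace.mpr (inferInstanceAs (CompactSpace (f ⁻¹ᵁ U).toScheme))

lemma isQuasiAffine_of_isPullback {X' S' X'' T' : Scheme.{u}} {x : X'' ⟶ X'} {f'' : X'' ⟶ T'}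
    {f : X' ⟶ S'} {t : T' ⟶ S'} (H : IsPullback x f'' f t) [IsQuasiAffineHom f] [IsAffine T'] :
    X''.IsQuasiAffine := by
  have : QuasiCompact f'' := MorphismProperty.of_isPullback (P := @QuasiCompact) H inferInstance
  have := QuasiCompact.compactSpace_of_compactSpace f''
  refine isQuasiAffine_of_forall_exists_basicOpen X'' fun y ↦ ?_
  obtain ⟨V, hV, hyV, -⟩ := exists_isAffineOpen_mem_and_subset (x := t (f'' y)) (U := ⊤) trivial
  obtain ⟨_, ⟨_, ⟨e, rfl⟩, rfl⟩, hye, heV⟩ := (isBasis_basicOpen T').exists_subset_of_mem_open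
    (show f'' y ∈ ((t ⁻¹ᵁ V : T'.Opens) : Set T') from hyV) (t ⁻¹ᵁ V).isOpen
  refine ⟨f''.appTop e, ?_, ?_⟩
  · rw [← Scheme.preimage_basicOpen_top]
    have : IsAffine (T'.basicOpen e).toScheme := (isAffineOpen_top T').basicOpen e
    have : IsAffine V.toScheme := hV
    let k : (T'.basicOpen e).toScheme ⟶ V.toScheme :=
      IsOpenImmersion.lift V.ι ((T'.basicOpen e).ι ≫ t) (by
        rw [Scheme.Opens.range_ι]
        rintro _ ⟨z, rfl⟩
        exact heV z.2)
    have hk : k ≫ V.ι = (T'.basicOpen e).ι ≫ t := IsOpenImmersion.lift_fac _ _ _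
    have h₁ := ((isPullback_morphismRestrict f'' (T'.basicOpen e)).flip.paste_horiz H).flip
    rw [← hk] at h₁
    have h₂ := isPullback_morphismRestrict f V
    have h₃ : h₂.lift (f'' ∣_ T'.basicOpen e ≫ k) ((f'' ⁻¹ᵁ T'.basicOpen e).ι ≫ x)
        (by rw [Category.assoc, h₁.w]) ≫ f ∣_ V = f'' ∣_ T'.basicOpen e ≫ k := h₂.lift_fst _ _ _
    have h₄ : IsPullback (f'' ∣_ T'.basicOpen e) (h₂.lift (f'' ∣_ T'.basicOpen e ≫ k)
        ((f'' ⁻¹ᵁ T'.basicOpen e).ι ≫ x) (by rw [Category.assoc, h₁.w])) k (f ∣_ V) := by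
      refine IsPullback.of_bot ?_ h₃.symm h₂
      rw [h₂.lift_snd]
      exact h₁
    have := IsQuasiAffineHom.isQuasiAffine_preimage (f := f) V hV
    have := MorphismProperty.of_isPullback (P := @IsAffineHom) h₄ inferInstance
    exact .of_isAffineHom (h₂.lift (f'' ∣_ T'.basicOpen e ≫ k)
      ((f'' ⁻¹ᵁ T'.basicOpen e).ι ≫ x) _)
  · rw [← Scheme.preimage_basicOpen_top]
    exact hye

section descent

variable {S S' X X' : Scheme.{u}} {q : X' ⟶ X} {f : X' ⟶ S'} {g : X ⟶ S} {π : S' ⟶ S}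
  (H : IsPullback q f g π) [IsAffine S] [IsAffine S'] [IsFlatCover π]

include H

/-- Flat base change for the canonical morphism to an affine scheme. -/
lemma isPullback_toSpecΓ [X'.IsQuasiAffine] :
    CompactSpace X ∧ IsPullback q X'.toSpecΓ X.toSpecΓ (Spec.map q.appTop) ∧
      IsFlatCover (Spec.map q.appTop) := by
  have := IsFlatCover.of_isPullback H
  have := MorphismProperty.of_isPullback (P := @QuasiCompact) H.flip inferInstance
  have : CompactSpace X := ⟨by
    rw [← q.surjective.range_eq]
    exact isCompact_range q.continuous⟩
  have : QuasiSeparatedSpace X := ⟨fun U V hU hU' hV hV' ↦ by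
    rw [← Set.image_preimage_eq (U ∩ V) q.surjective, Set.preimage_inter]
    exact (QuasiSeparatedSpace.inter_isCompact _ _ (hU.preimage q.continuous)
      (QuasiCompact.isCompact_preimage (f := q) _ hU hU') (hV.preimage q.continuous)
      (QuasiCompact.isCompact_preimage (f := q) _ hV hV')).image q.continuous⟩
  have H' := isPullback_SpecMap_of_isPushout _ _ _ _ (isPushout_appTop H)
  have H₀ : IsPullback π S'.toSpecΓ S.toSpecΓ (Spec.map π.appTop) :=
    .of_vert_isIso ⟨Scheme.toSpecΓ_naturality π⟩
  have H₁ : IsPullback (Spec.map π.appTop) S'.isoSpec.inv S.isoSpec.inv π :=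
    .of_vert_isIso ⟨Scheme.isoSpec_inv_naturality π⟩
  refine ⟨inferInstance, ?_, .of_isPullback (H'.paste_vert H₁)⟩
  refine IsPullback.of_bot ?_ (Scheme.toSpecΓ_naturality q) H'
  rw [← Scheme.toSpecΓ_naturality, ← Scheme.toSpecΓ_naturality]
  exact H.paste_vert H₀

/-- Being quasi-affine descends along flat covers of affine schemes by affine schemes. -/
lemma isQuasiAffine_of_isPullback_of_isFlatCover [X'.IsQuasiAffine] : X.IsQuasiAffine := by
  obtain ⟨_, h, _⟩ := isPullback_toSpecΓ H
  have : IsOpenImmersion X.toSpecΓ := MorphismProperty.of_isPullback_of_descendsAlong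
    (P := @IsOpenImmersion)
    (Q := (@Surjective ⊓ @Flat ⊓ @QuasiCompact : MorphismProperty Scheme.{u})) h.flip
    ⟨⟨inferInstance, inferInstance⟩, inferInstance⟩ inferInstance
  constructor

/-- Being affine descends along flat covers of affine schemes by affine schemes. -/
lemma isAffine_of_isPullback_of_isFlatCover [IsAffine X'] : IsAffine X := by
  obtain ⟨_, h, _⟩ := isPullback_toSpecΓ H
  exact ⟨IsFlatCover.isIso_of_isPullback h.flip⟩

end descent

lemma exists_isAffine_isFlatCover (X : Scheme.{u}) [CompactSpace X] :
    ∃ (Y : Scheme.{u}) (p : Y ⟶ X), IsFlatCover p ∧ IsAffine Y := by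
  have h : MorphismProperty.IsMultiplicative @IsLocalIso.{u} := inferInstance
  have h' : MorphismProperty.IsMultiplicative @Flat.{u} := inferInstance
  have := h.toContainsIdentities
  have := h'.toContainsIdentities
  have : MorphismProperty.ContainsIdentities @LocallyOfFinitePresentation.{u} :=
    ⟨fun X ↦ inferInstanceAs (LocallyOfFinitePresentation (𝟙 X))⟩
  obtain ⟨Y, p, hp, hp', hY⟩ := X.exists_hom_isAffine_of_isZariskiLocalAtSource @IsLocalIso.{u}
  have h₁ : HasRingHomProperty @Flat.{u} RingHom.Flat := inferInstance
  have h₂ : HasRingHomProperty @LocallyOfFinitePresentation.{u} RingHom.FinitePresentation :=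
    inferInstance
  have : IsZariskiLocalAtSource @Flat.{u} := HasRingHomProperty.instIsZariskiLocalAtSource
  have : IsZariskiLocalAtSource @LocallyOfFinitePresentation.{u} :=
    HasRingHomProperty.instIsZariskiLocalAtSource
  have : Flat p := IsLocalIso.le_of_isZariskiLocalAtSource @Flat.{u} _ _ p hp'
  have : LocallyOfFinitePresentation p :=
    IsLocalIso.le_of_isZariskiLocalAtSource @LocallyOfFinitePresentation.{u} _ _ p hp'
  exact ⟨Y, p, .of_locallyOfFinitePresentation p, hY⟩

section descentHom

variable {S S' X X' : Scheme.{u}} {q : X' ⟶ X} {f : X' ⟶ S'} {g : X ⟶ S} {π : S' ⟶ S}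
  (H : IsPullback q f g π) [IsFlatCover π] [QuasiCompact π]

include H

/-- The inverse image of an affine open is covered by an affine base change. -/
lemma exists_isPullback_preimage {U : S.Opens} (hU : IsAffineOpen U) :
    ∃ (T T' : Scheme.{u}) (t : T' ⟶ S') (p : T' ⟶ U) (a : T ⟶ X') (b : T ⟶ T')
      (c : T ⟶ (g ⁻¹ᵁ U).toScheme),
      IsAffine T' ∧ IsFlatCover p ∧ IsPullback a b f t ∧ IsPullback c b (g ∣_ U) p := by
  have : IsAffine U.toScheme := hU
  have := QuasiCompact.compactSpace_of_compactSpace (pullback.snd π U.ι)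
  obtain ⟨T', r, hr, hT'⟩ := exists_isAffine_isFlatCover (pullback π U.ι)
  have : IsFlatCover (pullback.snd π U.ι) := .of_isPullback (IsPullback.of_hasPullback π U.ι).flip
  have : Flat (r ≫ pullback.snd π U.ι) := inferInstance
  have : IsFlatCover (r ≫ pullback.snd π U.ι) := .of_quasiCompact _
  let t : T' ⟶ S' := r ≫ pullback.fst π U.ι
  have h₁ := IsPullback.of_hasPullback f t
  have h₂ := h₁.paste_horiz H
  have ht : t ≫ π = (r ≫ pullback.snd π U.ι) ≫ U.ι := by
    rw [Category.assoc, pullback.condition, Category.assoc]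
  have h₃ := (isPullback_morphismRestrict g U).flip
  rw [ht] at h₂
  refine ⟨_, T', t, _, _, _, h₃.lift _ _ (h₂.w.trans (Category.assoc _ _ _).symm), hT', this, h₁,
    IsPullback.of_right ?_ (h₃.lift_snd _ _ _) h₃⟩
  rw [h₃.lift_fst]
  exact h₂

lemma isQuasiAffineHom_of_isPullback [IsQuasiAffineHom f] : IsQuasiAffineHom g where
  isQuasiAffine_preimage U hU := by
    obtain ⟨T, T', t, p, a, b, c, _, _, h₁, h₂⟩ := exists_isPullback_preimage H hU
    have : IsAffine U.toScheme := hU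
    have := isQuasiAffine_of_isPullback h₁
    exact isQuasiAffine_of_isPullback_of_isFlatCover h₂

lemma isAffineHom_of_isPullback [IsAffineHom f] : IsAffineHom g where
  isAffine_preimage U hU := by
    obtain ⟨T, T', t, p, a, b, c, _, _, h₁, h₂⟩ := exists_isPullback_preimage H hU
    have : IsAffine U.toScheme := hU
    have := MorphismProperty.of_isPullback (P := @IsAffineHom) h₁ inferInstance
    have : IsAffine T := isAffine_of_isAffineHom b
    exact isAffine_of_isPullback_of_isFlatCover h₂

lemma isOpenImmersion_of_isPullback [IsOpenImmersion f] : IsOpenImmersion g :=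
  MorphismProperty.of_isPullback_of_descendsAlong (P := @IsOpenImmersion)
    (Q := (@Surjective ⊓ @Flat ⊓ @QuasiCompact : MorphismProperty Scheme.{u})) H.flip
    ⟨⟨inferInstance, inferInstance⟩, inferInstance⟩ inferInstance

end descentHom

/-- Effective descent for quasi-affine morphisms. -/
lemma PointAction.hasQuotient_of_isQuasiAffineHom {S S' X' : Scheme.{u}} {π : S' ⟶ S}
    {f : X' ⟶ S'} [IsFlatCover π] [QuasiCompact π] [IsQuasiAffineHom f] (A : PointAction π f) :
    A.HasQuotient := by
  refine .of_openCover S.directedAffineCover fun (U : S.affineOpens) ↦ ?_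
  change (A.restrict U.1.ι).HasQuotient
  have : IsAffine U.1.toScheme := U.2
  have := QuasiCompact.compactSpace_of_compactSpace (pullback.snd π U.1.ι)
  obtain ⟨T', r, hr, hT'⟩ := exists_isAffine_isFlatCover (pullback π U.1.ι)
  have : IsFlatCover (pullback.snd π U.1.ι) :=
    .of_isPullback (IsPullback.of_hasPullback π U.1.ι).flip
  have : IsFlatCover (r ≫ pullback.snd π U.1.ι) := .of_quasiCompact _
  have h := IsPullback.of_hasPullback (pullback.snd f (pullback.fst π U.1.ι)) r
  refine .of_baseChange h ?_
  have := isQuasiAffine_of_isPullback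
    (h.paste_horiz (IsPullback.of_hasPullback f (pullback.fst π U.1.ι)))
  exact hasQuotient_of_isQuasiAffine _

variable {S S' : Scheme.{u}} {π : S' ⟶ S} {X' : Over S'}

lemma lift_pullIso_fst (φ : (Over.pullback (p₁ π)).obj X' ≅ (Over.pullback (p₂ π)).obj X')
    {T U : Scheme.{u}} (g : T ⟶ pullback π π) (a b : T ⟶ S') (ha : g ≫ p₁ π = a)
    (hb : g ≫ p₂ π = b) (x : U ⟶ X'.left) (w : U ⟶ T) (h : x ≫ X'.hom = w ≫ a)
    (h' : x ≫ X'.hom = (w ≫ g) ≫ p₁ π) :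
    pullback.lift x w h ≫ (pullIso φ g a b ha hb).hom.left ≫ pullback.fst X'.hom b =
      pullback.lift x (w ≫ g) h' ≫ φ.hom.left ≫ pullback.fst X'.hom (p₂ π) := by
  have h₁ := pullbackCompIso_hom_left_fst X' g (p₂ π) b hb
  have h₂ : ((Over.pullback g).map φ.hom).left ≫ pullback.fst (pullback.snd X'.hom (p₂ π)) g =
      pullback.fst (pullback.snd X'.hom (p₁ π)) g ≫ φ.hom.left := pullback.lift_fst _ _ _
  have h₃ : pullback.lift x w h ≫ (pullbackCompIso X' g (p₁ π) a ha).inv.left ≫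
      pullback.fst (pullback.snd X'.hom (p₁ π)) g = pullback.lift x (w ≫ g) h' := by
    apply pullback.hom_ext
    · refine Eq.trans ?_ (pullback.lift_fst _ _ _).symm
      have := pullbackCompIso_inv_left_fst_fst X' g (p₁ π) a ha
      simp only [Category.assoc]
      exact (congrArg (_ ≫ ·) this).trans (pullback.lift_fst _ _ _)
    · refine Eq.trans ?_ (pullback.lift_snd _ _ _).symm
      have := pullbackCompIso_inv_left_snd X' g (p₁ π) a ha
      have e : pullback.fst (pullback.snd X'.hom (p₁ π)) g ≫ pullback.snd X'.hom (p₁ π) =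
        pullback.snd _ _ ≫ g := pullback.condition
      simp only [Category.assoc]
      refine (congrArg (_ ≫ _ ≫ ·) e).trans ?_
      refine (congrArg (_ ≫ ·) ((reassoc_of% this) g)).trans ?_
      exact pullback.lift_snd_assoc _ _ _ _
  change pullback.lift x w h ≫ ((pullbackCompIso X' g (p₁ π) a ha).inv.left ≫
    ((Over.pullback g).map φ.hom).left ≫ (pullbackCompIso X' g (p₂ π) b hb).hom.left) ≫ _ = _
  simp only [Category.assoc]
  refine (congrArg (_ ≫ _ ≫ _ ≫ ·) h₁).trans ?_
  refine (congrArg (_ ≫ _ ≫ ·) ((reassoc_of% h₂) _)).trans ?_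
  exact (reassoc_of% h₃) _

namespace DescentDatum

variable (D : DescentDatum π X')

/-- The transport of points defined by a descent datum. -/
noncomputable def act {T : Scheme.{u}} (x : T ⟶ X'.left) (s : T ⟶ S')
    (h : x ≫ X'.hom ≫ π = s ≫ π) : T ⟶ X'.left :=
  pullback.lift x (pullback.lift (x ≫ X'.hom) s (by rw [Category.assoc, h]))
    (pullback.lift_fst _ _ _).symm ≫ D.φ.hom.left ≫ pullback.fst X'.hom (p₂ π)

lemma act_eq {T : Scheme.{u}} (x : T ⟶ X'.left) (s : T ⟶ S') (h : x ≫ X'.hom ≫ π = s ≫ π)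
    (w : T ⟶ pullback π π) (h₁ : x ≫ X'.hom = w ≫ p₁ π) (h₂ : s = w ≫ p₂ π) :
    D.act x s h = pullback.lift x w h₁ ≫ D.φ.hom.left ≫ pullback.fst X'.hom (p₂ π) := by
  have : pullback.lift (x ≫ X'.hom) s (by rw [Category.assoc, h]) = w := by
    apply pullback.hom_ext
    · rw [pullback.lift_fst, h₁]
    · rw [pullback.lift_snd, h₂]
  subst this
  rfl

lemma act_comp {T : Scheme.{u}} (x : T ⟶ X'.left) (s : T ⟶ S') (h : x ≫ X'.hom ≫ π = s ≫ π) :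
    D.act x s h ≫ X'.hom = s := by
  have h₁ : D.φ.hom.left ≫ pullback.snd X'.hom (p₂ π) = pullback.snd X'.hom (p₁ π) :=
    Over.w D.φ.hom
  have h₂ : pullback.fst X'.hom (p₂ π) ≫ X'.hom = pullback.snd X'.hom (p₂ π) ≫ p₂ π :=
    pullback.condition
  rw [act, Category.assoc, Category.assoc]
  refine (congrArg (_ ≫ _ ≫ ·) h₂).trans ?_
  refine (congrArg (_ ≫ ·) ((reassoc_of% h₁) _)).trans ?_
  rw [pullback.lift_snd_assoc, pullback.lift_snd]

lemma act_act {T : Scheme.{u}} (x : T ⟶ X'.left) (s t : T ⟶ S') (h : x ≫ X'.hom ≫ π = s ≫ π)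
    (h' : D.act x s h ≫ X'.hom ≫ π = t ≫ π) (h'' : x ≫ X'.hom ≫ π = t ≫ π) :
    D.act (D.act x s h) t h' = D.act x t h'' := by
  have hst : s ≫ π = t ≫ π := by rw [← h, h'']
  let w : T ⟶ triple π := pullback.lift (pullback.lift (x ≫ X'.hom) s (by rw [Category.assoc, h]))
    (pullback.lift s t hst) (by rw [pullback.lift_snd, pullback.lift_fst])
  have hw₁₂ : w ≫ p₁₂ π = pullback.lift (x ≫ X'.hom) s (by rw [Category.assoc, h]) :=
    pullback.lift_fst _ _ _
  have hw₂₃ : w ≫ p₂₃ π = pullback.lift s t hst := pullback.lift_snd _ _ _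
  have hw₁ : w ≫ q₁ π = x ≫ X'.hom := by rw [reassoc_of% hw₁₂, pullback.lift_fst]
  have hw₂ : w ≫ q₂ π = s := by rw [reassoc_of% hw₁₂, pullback.lift_snd]
  have hw₃ : w ≫ q₃ π = t := by rw [reassoc_of% hw₂₃, pullback.lift_snd]
  have hw₁₃₁ : (w ≫ p₁₃ π) ≫ p₁ π = x ≫ X'.hom := by rw [Category.assoc, pullback.lift_fst, hw₁]
  have hw₁₃₂ : (w ≫ p₁₃ π) ≫ p₂ π = t := by rw [Category.assoc, pullback.lift_snd, hw₃]
  have h₁₂ : pullback.lift x w hw₁.symm ≫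
      (pullIso D.φ (p₁₂ π) (q₁ π) (q₂ π) rfl rfl).hom.left =
        pullback.lift (D.act x s h) w (by rw [act_comp, hw₂]) := by
    apply pullback.hom_ext
    · rw [pullback.lift_fst, Category.assoc]
      refine (lift_pullIso_fst D.φ _ _ _ rfl rfl x w hw₁.symm
        (by rw [Category.assoc, hw₁])).trans ?_
      exact (D.act_eq x s h _ _ (by rw [Category.assoc, hw₂])).symm
    · rw [pullback.lift_snd, Category.assoc]
      refine (congrArg (_ ≫ ·) (Over.w (pullIso D.φ (p₁₂ π) (q₁ π) (q₂ π) rfl rfl).hom)).trans ?_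
      exact pullback.lift_snd _ _ _
  have key := congrArg (fun e ↦ pullback.lift x w hw₁.symm ≫ e.hom.left ≫
    pullback.fst X'.hom (q₃ π)) D.cocycle
  have hl : (pullback.lift x w hw₁.symm ≫ (pullIso D.φ (p₁₂ π) (q₁ π) (q₂ π) rfl rfl).hom.left) ≫
      (pullIso D.φ (p₂₃ π) (q₂ π) (q₃ π) (p₂₃_p₁ π) rfl).hom.left ≫ pullback.fst X'.hom (q₃ π) =
      D.act (D.act x s h) t h' := by
    rw [h₁₂]
    refine (lift_pullIso_fst D.φ _ _ _ (p₂₃_p₁ π) rfl (D.act x s h) w _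
      (by rw [act_comp, hw₂₃, pullback.lift_fst])).trans ?_
    exact (D.act_eq _ t h' _ _ (by rw [hw₂₃, pullback.lift_snd])).symm
  have hr := lift_pullIso_fst D.φ (p₁₃ π) (q₁ π) (q₃ π) (pullback.lift_fst _ _ _)
    (pullback.lift_snd _ _ _) x w hw₁.symm hw₁₃₁.symm
  rw [← D.act_eq x t h'' _ hw₁₃₁.symm hw₁₃₂.symm] at hr
  rw [← hl, ← hr, Category.assoc]
  refine Eq.trans ?_ key
  simp only [Iso.trans_hom, Over.comp_left, Category.assoc]

lemma comp_act {T U : Scheme.{u}} (v : U ⟶ T) (x : T ⟶ X'.left) (s : T ⟶ S')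
    (h : x ≫ X'.hom ≫ π = s ≫ π) (h' : (v ≫ x) ≫ X'.hom ≫ π = (v ≫ s) ≫ π) :
    v ≫ D.act x s h = D.act (v ≫ x) (v ≫ s) h' := by
  rw [D.act_eq (v ≫ x) (v ≫ s) h' (v ≫ pullback.lift (x ≫ X'.hom) s (by rw [Category.assoc, h]))
    (by rw [Category.assoc, Category.assoc, pullback.lift_fst])
    (by rw [Category.assoc, pullback.lift_snd]), act, ← Category.assoc]
  congr 1
  apply pullback.hom_ext
  · rw [Category.assoc, pullback.lift_fst, pullback.lift_fst]
  · rw [Category.assoc, pullback.lift_snd, pullback.lift_snd]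

lemma act_injective {T : Scheme.{u}} (x y : T ⟶ X'.left) (s : T ⟶ S')
    (hx : x ≫ X'.hom ≫ π = s ≫ π) (hy : y ≫ X'.hom ≫ π = s ≫ π) (hxy : x ≫ X'.hom = y ≫ X'.hom)
    (h : D.act x s hx = D.act y s hy) : x = y := by
  let w : T ⟶ pullback π π := pullback.lift (x ≫ X'.hom) s (by rw [Category.assoc, hx])
  have hw₁ : w ≫ p₁ π = x ≫ X'.hom := pullback.lift_fst _ _ _
  have hw₂ : w ≫ p₂ π = s := pullback.lift_snd _ _ _
  have hs : D.φ.hom.left ≫ pullback.snd X'.hom (p₂ π) = pullback.snd X'.hom (p₁ π) :=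
    Over.w D.φ.hom
  rw [D.act_eq x s hx w hw₁.symm hw₂.symm,
    D.act_eq y s hy w (hxy.symm.trans hw₁.symm) hw₂.symm] at h
  have key : pullback.lift x w hw₁.symm ≫ D.φ.hom.left =
      pullback.lift y w (hxy.symm.trans hw₁.symm) ≫ D.φ.hom.left := by
    apply pullback.hom_ext (f := X'.hom) (g := p₂ π)
    · rw [Category.assoc, Category.assoc]
      exact h
    · rw [Category.assoc, Category.assoc]
      refine (congrArg (_ ≫ ·) hs).trans (Eq.trans ?_ (congrArg (_ ≫ ·) hs).symm)
      rw [pullback.lift_snd, pullback.lift_snd]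
  have : IsIso D.φ.hom.left := inferInstanceAs (IsIso ((Over.forget _).map D.φ.hom))
  rw [cancel_mono] at key
  have := congrArg (· ≫ pullback.fst _ _) key
  rwa [pullback.lift_fst, pullback.lift_fst] at this

/-- The action attached to a descent datum. -/
noncomputable def pointAction : PointAction π X'.hom where
  act := D.act
  act_comp := D.act_comp
  act_self x s h e := by
    refine D.act_injective _ _ s (by rw [reassoc_of% D.act_comp]) h ?_ ?_
    · rw [D.act_comp, e]
    · exact D.act_act _ _ _ _ _ _
  act_act := D.act_act
  comp_act := D.comp_act

lemma isInducedBy_of_isQuotient {X : Scheme.{u}} {q : X'.left ⟶ X} {g : X ⟶ S}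
    (h : D.pointAction.IsQuotient q g) : D.IsInducedBy (Over.mk g) := by
  let e : (Over.pullback π).obj (Over.mk g) ≅ X' :=
    Over.isoMk h.isPullback.isoPullback.symm h.isPullback.isoPullback_inv_snd
  have heq : e.hom.left ≫ q = pullback.fst g π := h.isPullback.isoPullback_inv_fst
  have hef : e.hom.left ≫ X'.hom = pullback.snd g π := h.isPullback.isoPullback_inv_snd
  refine ⟨e, ?_⟩
  have h₁ : ((Over.pullback (p₁ π)).map e.hom).left ≫ pullback.fst X'.hom (p₁ π) =
    pullback.fst (pullback.snd g π) (p₁ π) ≫ e.hom.left := pullback.lift_fst _ _ _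
  have h₁' : ((Over.pullback (p₁ π)).map e.hom).left ≫ pullback.snd X'.hom (p₁ π) =
    pullback.snd (pullback.snd g π) (p₁ π) := Over.w ((Over.pullback (p₁ π)).map e.hom)
  have h₂ : ((Over.pullback (p₂ π)).map e.hom).left ≫ pullback.fst X'.hom (p₂ π) =
    pullback.fst (pullback.snd g π) (p₂ π) ≫ e.hom.left := pullback.lift_fst _ _ _
  have h₃ := canonicalIso_hom_left_fst_fst π (Over.mk g)
  have h₄ : (canonicalIso π (Over.mk g)).hom.left ≫ pullback.snd (pullback.snd g π) (p₂ π) =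
    pullback.snd (pullback.snd g π) (p₁ π) := Over.w (canonicalIso π (Over.mk g)).hom
  have hcond : (pullback.fst (pullback.snd g π) (p₁ π) ≫ e.hom.left) ≫ X'.hom ≫ π =
      (pullback.snd (pullback.snd g π) (p₁ π) ≫ p₂ π) ≫ π := by
    rw [Category.assoc, reassoc_of% hef, pullback.condition_assoc, Category.assoc,
      pullback.condition]
  have hact : ((Over.pullback (p₁ π)).map e.hom).left ≫ D.φ.hom.left ≫
      pullback.fst X'.hom (p₂ π) = D.act (pullback.fst (pullback.snd g π) (p₁ π) ≫ e.hom.left)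
        (pullback.snd (pullback.snd g π) (p₁ π) ≫ p₂ π) hcond := by
    rw [D.act_eq _ _ _ (pullback.snd (pullback.snd g π) (p₁ π))
      (by rw [Category.assoc, hef, pullback.condition]) rfl]
    congr 1
  ext1
  apply pullback.hom_ext (f := X'.hom) (g := p₂ π)
  · have hl : ((DescentDatum.ofBase π (Over.mk g)).φ.hom ≫
        (Over.pullback (p₂ π)).map e.hom).left ≫ pullback.fst X'.hom (p₂ π) =
        (canonicalIso π (Over.mk g)).hom.left ≫
          pullback.fst (pullback.snd g π) (p₂ π) ≫ e.hom.left :=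
      (Category.assoc _ _ _).trans (congrArg (_ ≫ ·) h₂)
    have hr : ((Over.pullback (p₁ π)).map e.hom ≫ D.φ.hom).left ≫ pullback.fst X'.hom (p₂ π) =
        D.act _ _ hcond := (Category.assoc _ _ _).trans hact
    rw [hl, hr]
    apply h.isPullback.hom_ext
    · rw [Category.assoc, Category.assoc, heq]
      refine h₃.trans (Eq.trans ?_ (h.isInvariant _ _ hcond).symm)
      rw [Category.assoc, heq]
      rfl
    · rw [D.act_comp, Category.assoc, Category.assoc, hef]
      refine (congrArg (_ ≫ ·) pullback.condition).trans ?_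
      exact (reassoc_of% h₄) _
  · exact (Over.w ((DescentDatum.ofBase π (Over.mk g)).φ.hom ≫
      (Over.pullback (p₂ π)).map e.hom)).trans
        (Over.w ((Over.pullback (p₁ π)).map e.hom ≫ D.φ.hom)).symm

lemma isEffective_of_hasQuotient (h : D.pointAction.HasQuotient) : D.IsEffective := by
  obtain ⟨X, q, g, hq⟩ := h
  exact ⟨Over.mk g, D.isInducedBy_of_isQuotient hq⟩

variable {D} in
lemma IsInducedBy.exists_isPullback {X : Over S} (h : D.IsInducedBy X) :
    ∃ q : X'.left ⟶ X.left, IsPullback q X'.hom X.hom π := by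
  obtain ⟨e, -⟩ := h
  have h₁ : e.inv.left ≫ pullback.snd X.hom π = X'.hom := Over.w e.inv
  refine ⟨e.inv.left ≫ pullback.fst X.hom π, ?_⟩
  refine IsPullback.of_iso_pullback ⟨?_⟩ ((Over.forget S').mapIso e.symm) rfl h₁
  refine Eq.trans ?_ (congrArg (· ≫ π) h₁)
  simp only [Category.assoc]
  exact congrArg (e.inv.left ≫ ·) pullback.condition

end DescentDatum

end FpqcDescent

theorem mainTheorem10 {S S' : Scheme.{u}} (π : S' ⟶ S) [Flat π] [Surjective π] [QuasiCompact π]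
    (X' : Over S') (D : FpqcDescent.DescentDatum π X') :
    (IsAffineHom X'.hom →
      D.IsEffective ∧ ∀ X : Over S, D.IsInducedBy X → IsAffineHom X.hom) ∧
    (IsOpenImmersion X'.hom →
      D.IsEffective ∧ ∀ X : Over S, D.IsInducedBy X → IsOpenImmersion X.hom) ∧
    (FpqcDescent.IsQuasiAffineHom X'.hom →
      D.IsEffective ∧ ∀ X : Over S, D.IsInducedBy X → FpqcDescent.IsQuasiAffineHom X.hom) := by
  refine ⟨fun _ ↦ ⟨?_, fun X hX ↦ ?_⟩, fun _ ↦ ⟨?_, fun X hX ↦ ?_⟩, fun _ ↦ ⟨?_, fun X hX ↦ ?_⟩⟩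
  · exact D.isEffective_of_hasQuotient (FpqcDescent.PointAction.hasQuotient_of_isQuasiAffineHom _)
  · obtain ⟨q, hq⟩ := hX.exists_isPullback
    exact FpqcDescent.isAffineHom_of_isPullback hq
  · exact D.isEffective_of_hasQuotient (FpqcDescent.PointAction.hasQuotient_of_isOpenImmersion _)
  · obtain ⟨q, hq⟩ := hX.exists_isPullback
    exact FpqcDescent.isOpenImmersion_of_isPullback hq
  · exact D.isEffective_of_hasQuotient (FpqcDescent.PointAction.hasQuotient_of_isQuasiAffineHom _)
  · obtain ⟨q, hq⟩ := hX.exists_isPullback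
    exact FpqcDescent.isQuasiAffineHom_of_isPullback hq
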